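/- Let $F$ be a non-abelian free group with free generating set $(x_i)_{i\in I}$. For $n\ge 0$ let $H_b^n(F,\mathbb R)$ be the bounded cohomology of $F$ with trivial real coefficients, that is, the cohomology of the complex of bounded functions $F^n\to\mathbb R$ with the inhomogeneous coboundary $$\delta^n f(g_1,\dots,g_{n+1})=f(g_2,\dots,g_{n+1})+\sum_{j=1}^{n}(-1)^j f(g_1,\dots,g_jg_{j+1},\dots,g_{n+1})+(-1)^{n+1}f(g_1,\dots,g_n),$$ and let $\cup:H_b^n(F,\mathbb R)\times H_b^m(F,\mathbb R)\to H_b^{n+m}(F,\mathbb R)$ be the cup product, induced by $(f\cup g)(g_1,\dots,g_{n+m})=f(g_1,\dots,g_n)\,g(g_{n+1},\dots,g_{n+m})$. Let $\phi:F\to\mathbb R$ be one of the following functions. 1. A (big) Brooks quasimorphism: for some reduced word $w$ in the $x_i^{\pm1}$ (selfoverlapping or not), $\phi(g)$ is the number of occurrences of $w$ as a subword of the reduced word of $g$, minus the number of occurrences of $w^{-1}$, where overlapping occurrences are all counted. 2. A Rolli quasimorphism: for some functions $\lambda_i:\mathbb Z\to\mathbb R$ $(i\in I)$ with $\lambda_i(-m)=-\lambda_i(m)$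 and $\sup_{i,m}|\lambda_i(m)|<\infty$ (when $I$ is finite, this says that each $\lambda_i$ is bounded), $\phi(g)=\sum_{r=1}^{l}\lambda_{j_r}(m_r)$ whenever $g=x_{j_1}^{m_1}\cdots x_{j_l}^{m_l}$ with all $m_r\in\mathbb Z\setminus\{0\}$ and $j_r\ne j_{r+1}$ for all $r$. Then $\phi$ is a quasimorphism, i.e. $\sup_{g,h\in F}|\phi(g)+\phi(h)-\phi(gh)|<\infty$, so that $\delta^1\phi$ is a bounded cocycle with a class $[\delta^1\phi]\in H_b^2(F,\mathbb R)$, and for every $k>0$ and every $\alpha\in H_b^k(F,\mathbb R)$, $$[\delta^1\phi]\cup\alpha=0\quad\text{in } H_b^{k+2}(F,\mathbb R).$$ -/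

import Mathlib

/-! ### Bounded cohomology with trivial real coefficients (inhomogeneous cochains) -/

namespace BddCoh

section Cochains

variable (G : Type*) [Group G]

/-- `C^n(G, ℝ)`: all functions `G^n → ℝ`. -/
abbrev Cochain (n : ℕ) : Type _ := (Fin n → G) → ℝ

variable {G}

/-- The inhomogeneous coboundary map `δ^n : C^n(G, ℝ) → C^{n+1}(G, ℝ)`,
`δf(g₁,…,g_{n+1}) = f(g₂,…,g_{n+1}) + ∑_{j=1}^{n} (-1)^j f(g₁,…,g_j g_{j+1},…,g_{n+1})
  + (-1)^{n+1} f(g₁,…,g_n)`.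
In the sum below the index `j : Fin (n + 1)` is shifted by one, and `Fin.contractNth j` with
`j = n` drops the last entry, which gives the last term. -/
def coboundary (n : ℕ) : Cochain G n →ₗ[ℝ] Cochain G (n + 1) where
  toFun f g := f (fun i => g i.succ) +
    ∑ j : Fin (n + 1), (-1 : ℝ) ^ ((j : ℕ) + 1) * f (Fin.contractNth j (· * ·) g)
  map_add' f₁ f₂ := by
    ext g
    simp only [Pi.add_apply, mul_add, Finset.sum_add_distrib]
    ring
  map_smul' r f := by
    ext g
    simp only [Pi.smul_apply, smul_eq_mul, RingHom.id_apply, mul_add, Finset.mul_sum]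
    congr 1
    exact Finset.sum_congr rfl fun j _ => by ring

theorem coboundary_apply (n : ℕ) (f : Cochain G n) (g : Fin (n + 1) → G) :
    coboundary n f g = f (fun i => g i.succ) +
      ∑ j : Fin (n + 1), (-1 : ℝ) ^ ((j : ℕ) + 1) * f (Fin.contractNth j (· * ·) g) := rfl

theorem coboundary_coboundary (n : ℕ) (f : Cochain G n) :
    coboundary (n + 1) (coboundary n f) = 0 := by
  have key : ∀ (m : ℕ) (u : Cochain G m),
      (inhomogeneousCochains.d (Rep.trivial (ULift ℝ) G (ULift ℝ)) m).hom
        (fun x => ULift.up (u x)) = fun x => ULift.up (coboundary m u x) := by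
    intro m u
    funext x
    apply ULift.down_injective
    rw [inhomogeneousCochains.d_hom_apply]
    change ULift.ringEquiv _ = coboundary m u x
    erw [map_add, map_sum]
    rw [coboundary_apply]
    rfl
  have h := groupCohomology.inhomogeneousCochains.d_comp_d n (Rep.trivial (ULift ℝ) G (ULift ℝ))
  have h2 := congrArg (fun φ => φ.hom (fun x => ULift.up (f x))) h
  have h3 := (key (n + 1) (coboundary n f)).symm.trans
    ((congrArg (inhomogeneousCochains.d (Rep.trivial (ULift ℝ) G (ULift ℝ)) (n + 1)).hom
      (key n f)).symm.trans h2)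
  funext x
  exact congrArg ULift.down (congrFun h3 x)

/-- `C_b^n(G, ℝ)`: the bounded cochains. -/
def bounded (G : Type*) [Group G] (n : ℕ) : Submodule ℝ (Cochain G n) where
  carrier := {f | ∃ C : ℝ, ∀ g, |f g| ≤ C}
  zero_mem' := ⟨0, fun g => by simp⟩
  add_mem' := by
    rintro a b ⟨C, hC⟩ ⟨D, hD⟩
    exact ⟨C + D, fun g => (abs_add_le _ _).trans (add_le_add (hC g) (hD g))⟩
  smul_mem' := by
    rintro r a ⟨C, hC⟩
    refine ⟨|r| * C, fun g => ?_⟩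
    rw [Pi.smul_apply, smul_eq_mul, abs_mul]
    exact mul_le_mul_of_nonneg_left (hC g) (abs_nonneg r)

/-- The bounded `n`-cocycles: `Ker (C_b^n → C_b^{n+1})`. -/
def cocycles (G : Type*) [Group G] (n : ℕ) : Submodule ℝ (Cochain G n) :=
  bounded G n ⊓ LinearMap.ker (coboundary n)

/-- The bounded `n`-coboundaries: `Im (C_b^{n-1} → C_b^n)`, which is `0` for `n = 0`. -/
def coboundaries (G : Type*) [Group G] : (n : ℕ) → Submodule ℝ (Cochain G n)
  | 0 => ⊥
  | n + 1 => (bounded G n).map (coboundary n)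

theorem coboundary_mem_bounded {n : ℕ} {f : Cochain G n} (hf : f ∈ bounded G n) :
    coboundary n f ∈ bounded G (n + 1) := by
  obtain ⟨C, hC⟩ := hf
  refine ⟨C + ∑ _j : Fin (n + 1), C, fun g => ?_⟩
  rw [coboundary_apply]
  refine (abs_add_le _ _).trans (add_le_add (hC _) ?_)
  refine (Finset.abs_sum_le_sum_abs _ _).trans (Finset.sum_le_sum fun j _ => ?_)
  rw [abs_mul, abs_pow, abs_neg, abs_one, one_pow, one_mul]
  exact hC _

theorem coboundaries_le_cocycles (n : ℕ) : coboundaries G n ≤ cocycles G n := by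
  cases n with
  | zero => exact bot_le
  | succ n =>
    rintro _ ⟨f, hf, rfl⟩
    exact ⟨coboundary_mem_bounded hf, coboundary_coboundary n f⟩

variable (G)

/-- The bounded cohomology `H_b^n(G, ℝ)`: bounded cocycles modulo bounded coboundaries. -/
abbrev Hb (n : ℕ) : Type _ :=
  cocycles G n ⧸ (coboundaries G n).submoduleOf (cocycles G n)

variable {G}

/-- The class in `H_b^n(G, ℝ)` of a bounded cocycle. -/
def Hb.mk {n : ℕ} (f : cocycles G n) : Hb G n :=
  Submodule.Quotient.mk f

/-! ### The cup product -/

/-- The cup product of cochains,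
`(f ∪ g)(x₁,…,x_{n+m}) = f(x₁,…,x_n) * g(x_{n+1},…,x_{n+m})`. -/
def cupCochain {n m : ℕ} (f : Cochain G n) (g : Cochain G m) : Cochain G (n + m) :=
  fun x => f (fun i => x (Fin.castAdd m i)) * g (fun i => x (Fin.natAdd n i))

theorem cupCochain_mem_bounded {n m : ℕ} {f : Cochain G n} {g : Cochain G m}
    (hf : f ∈ bounded G n) (hg : g ∈ bounded G m) : cupCochain f g ∈ bounded G (n + m) := by
  obtain ⟨C, hC⟩ := hf
  obtain ⟨D, hD⟩ := hg
  refine ⟨C * D, fun x => ?_⟩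
  rw [cupCochain, abs_mul]
  exact mul_le_mul (hC _) (hD _) (abs_nonneg _) ((abs_nonneg _).trans (hC fun _ => 1))

/-- The Leibniz rule `δ(f ∪ g) = δf ∪ g + (-1)^n f ∪ δg`, evaluated at a tuple. -/
theorem coboundary_cupCochain {n m : ℕ} (f : Cochain G n) (g : Cochain G m)
    (x : Fin (n + m + 1) → G) :
    coboundary (n + m) (cupCochain f g) x =
      coboundary n f (fun i => x ⟨i, by omega⟩) * g (fun i => x ⟨n + 1 + i, by omega⟩) +
      (-1) ^ n * (f (fun i => x ⟨i, by omega⟩) *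
        coboundary m g (fun i => x ⟨n + i, by omega⟩)) := by
  simp only [coboundary_apply]
  have e : ∑ j : Fin (n + m + 1),
        (-1 : ℝ) ^ ((j : ℕ) + 1) * cupCochain f g (Fin.contractNth j (· * ·) x) =
      (∑ j : Fin n, (-1 : ℝ) ^ ((j : ℕ) + 1) *
        (f (Fin.contractNth j.castSucc (· * ·) (fun i => x ⟨i, by omega⟩)) *
          g (fun i => x ⟨n + 1 + i, by omega⟩))) +
      ∑ j : Fin (m + 1), (-1 : ℝ) ^ (n + (j : ℕ) + 1) *
        (f (fun i => x ⟨i, by omega⟩) *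
          g (Fin.contractNth j (· * ·) (fun i => x ⟨n + i, by omega⟩))) := by
    refine (Fin.sum_univ_add (a := n) (b := m + 1) (fun j : Fin (n + (m + 1)) =>
      (-1 : ℝ) ^ ((j : ℕ) + 1) *
        cupCochain f g (Fin.contractNth (n := n + m) j (· * ·) x))).trans ?_
    congr 1
    · refine Finset.sum_congr rfl fun j _ => ?_
      unfold cupCochain
      congr 2
      · congr 1
        funext i
        have hj := j.2
        rw [Fin.contractNth_apply_of_gt]
        · congr 1
          refine Fin.ext ?_
          simp only [Fin.val_succ, Fin.val_natAdd]
          omega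
        · simp only [Fin.val_castAdd, Fin.val_natAdd]
          omega
    · refine Finset.sum_congr rfl fun j _ => ?_
      unfold cupCochain
      congr 2
      · congr 1
        funext i
        have hi := i.2
        rw [Fin.contractNth_apply_of_lt]
        · rfl
        · simp
          omega
      · congr 1
        funext i
        simp only [Fin.contractNth, Fin.val_natAdd]
        simp only [Nat.add_lt_add_iff_left, Nat.add_left_cancel_iff]
        rfl
  rw [e, Fin.sum_univ_castSucc (n := n)]
  have hlast : (Fin.contractNth (Fin.last n) (· * ·) (fun i : Fin (n + 1) =>
      x ⟨i, by omega⟩)) = fun i : Fin n => x ⟨i, by omega⟩ := by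
    funext i
    rw [Fin.contractNth_apply_of_lt _ _ _ _ (by simp)]
    rfl
  have h0 : cupCochain f g (fun i => x i.succ) =
      f (fun i => x ⟨i.succ, by omega⟩) * g (fun i => x ⟨n + 1 + i, by omega⟩) := by
    unfold cupCochain
    congr 2
    funext i
    refine congrArg x (Fin.ext ?_)
    simp only [Fin.val_succ, Fin.val_natAdd]
    omega
  have h1 : (fun i : Fin m => x ⟨n + i.succ, by have := i.2; simp only [Fin.val_succ]; omega⟩) =
      fun i : Fin m => x ⟨n + 1 + i, by omega⟩ := by
    funext i
    congr 1
    refine Fin.ext ?_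
    simp only [Fin.val_succ]
    omega
  rw [hlast, h0, h1, mul_add, mul_add, Finset.mul_sum, Finset.mul_sum, add_mul, add_mul,
    Finset.sum_mul]
  have h2 : ∑ j : Fin n, (-1 : ℝ) ^ ((j : ℕ) + 1) *
        (f (Fin.contractNth j.castSucc (· * ·) (fun i => x ⟨i, by omega⟩)) *
          g (fun i => x ⟨n + 1 + i, by omega⟩)) =
      ∑ j : Fin n, (-1 : ℝ) ^ ((j.castSucc : ℕ) + 1) *
        f (Fin.contractNth j.castSucc (· * ·) (fun i => x ⟨i, by omega⟩)) *
          g (fun i => x ⟨n + 1 + i, by omega⟩) :=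
    Finset.sum_congr rfl fun j _ => by rw [Fin.val_castSucc]; ring
  have h3 : ∑ j : Fin (m + 1), (-1 : ℝ) ^ (n + (j : ℕ) + 1) *
        (f (fun i => x ⟨i, by omega⟩) *
          g (Fin.contractNth j (· * ·) (fun i => x ⟨n + i, by omega⟩))) =
      ∑ j : Fin (m + 1), (-1 : ℝ) ^ n * (f (fun i => x ⟨i, by omega⟩) *
        ((-1 : ℝ) ^ ((j : ℕ) + 1) *
          g (Fin.contractNth j (· * ·) (fun i => x ⟨n + i, by omega⟩)))) :=
    Finset.sum_congr rfl fun j _ => by ring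
  rw [h2, h3, Fin.val_last]
  ring

theorem cupCochain_mem_cocycles {n m : ℕ} {f : Cochain G n} {g : Cochain G m}
    (hf : f ∈ cocycles G n) (hg : g ∈ cocycles G m) : cupCochain f g ∈ cocycles G (n + m) := by
  refine ⟨cupCochain_mem_bounded hf.1 hg.1, ?_⟩
  have hf' : coboundary n f = 0 := hf.2
  have hg' : coboundary m g = 0 := hg.2
  change coboundary (n + m) (cupCochain f g) = 0
  funext x
  rw [coboundary_cupCochain, hf', hg']
  simp

theorem mem_coboundaries_of_eq {p q : ℕ} (h : q + 1 = p) {f : Cochain G p} {u : Cochain G q}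
    (hu : u ∈ bounded G q) (hf : ∀ x, f x = coboundary q u (fun i => x (Fin.cast h i))) :
    f ∈ coboundaries G p := by
  subst h
  exact ⟨u, hu, funext fun x => (hf x).symm⟩

theorem cupCochain_mem_coboundaries_left {n m : ℕ} {f : Cochain G n} {g : Cochain G m}
    (hf : f ∈ coboundaries G n) (hg : g ∈ cocycles G m) :
    cupCochain f g ∈ coboundaries G (n + m) := by
  cases n with
  | zero =>
    have h0 : f = 0 := hf
    have : cupCochain f g = 0 := by
      funext x
      simp [cupCochain, h0]
    rw [this]
    exact Submodule.zero_mem _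
  | succ n =>
    obtain ⟨u, hu, rfl⟩ := hf
    have hg' : coboundary m g = 0 := hg.2
    refine mem_coboundaries_of_eq (q := n + m) (by omega) (cupCochain_mem_bounded hu hg.1) ?_
    intro x
    rw [coboundary_cupCochain, hg']
    simp only [Pi.zero_apply, mul_zero, add_zero]
    rfl

theorem cupCochain_mem_coboundaries_right {n m : ℕ} {f : Cochain G n} {g : Cochain G m}
    (hf : f ∈ cocycles G n) (hg : g ∈ coboundaries G m) :
    cupCochain f g ∈ coboundaries G (n + m) := by
  cases m with
  | zero =>
    have h0 : g = 0 := hg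
    have : cupCochain f g = 0 := by
      funext x
      simp [cupCochain, h0]
    rw [this]
    exact Submodule.zero_mem _
  | succ m =>
    obtain ⟨u, hu, rfl⟩ := hg
    have hf' : coboundary n f = 0 := hf.2
    refine mem_coboundaries_of_eq (q := n + m) rfl
      (Submodule.smul_mem _ ((-1 : ℝ) ^ n) (cupCochain_mem_bounded hf.1 hu)) ?_
    intro x
    rw [map_smul, Pi.smul_apply, coboundary_cupCochain, hf']
    simp only [Pi.zero_apply, zero_mul, zero_add, smul_eq_mul]
    rw [← mul_assoc, ← mul_pow]
    simp only [mul_neg, mul_one, neg_neg, one_pow, one_mul]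
    rfl

/-- The cup product `H_b^n(G, ℝ) × H_b^m(G, ℝ) → H_b^{n+m}(G, ℝ)`, `([f], [g]) ↦ [f ∪ g]`. -/
def cup {n m : ℕ} : Hb G n → Hb G m → Hb G (n + m) :=
  Quotient.map₂
    (fun f g => ⟨cupCochain f.1 g.1, cupCochain_mem_cocycles f.2 g.2⟩)
    (by
      intro f₁ f₂ hf g₁ g₂ hg
      have hf' : f₁ - f₂ ∈ (coboundaries G n).submoduleOf (cocycles G n) :=
        (Submodule.quotientRel_def _).1 hf
      have hg' : g₁ - g₂ ∈ (coboundaries G m).submoduleOf (cocycles G m) :=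
        (Submodule.quotientRel_def _).1 hg
      refine (Submodule.quotientRel_def _).2 ?_
      change cupCochain f₁.1 g₁.1 - cupCochain f₂.1 g₂.1 ∈ coboundaries G (n + m)
      have e : cupCochain f₁.1 g₁.1 - cupCochain f₂.1 g₂.1 =
          cupCochain (f₁.1 - f₂.1) g₁.1 + cupCochain f₂.1 (g₁.1 - g₂.1) := by
        funext x
        simp only [cupCochain, Pi.sub_apply, Pi.add_apply]
        ring
      rw [e]
      exact Submodule.add_mem _ (cupCochain_mem_coboundaries_left hf' g₁.2)
        (cupCochain_mem_coboundaries_right f₂.2 hg'))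

theorem cup_mk_mk {n m : ℕ} (f : cocycles G n) (g : cocycles G m) :
    cup (Hb.mk f) (Hb.mk g) =
      Hb.mk ⟨cupCochain f.1 g.1, cupCochain_mem_cocycles f.2 g.2⟩ := rfl

/-! ### Quasimorphisms and their classes -/

/-- A quasimorphism on `G`: a real function that is additive up to a bounded error. -/
def IsQuasimorphism (φ : G → ℝ) : Prop :=
  ∃ D : ℝ, ∀ g h : G, |φ g + φ h - φ (g * h)| ≤ D

/-- A function on `G` as a cochain of degree one. -/
def toCochain (φ : G → ℝ) : Cochain G 1 := fun x => φ (x 0)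

theorem coboundary_toCochain (φ : G → ℝ) (x : Fin 2 → G) :
    coboundary 1 (toCochain φ) x = φ (x 0) + φ (x 1) - φ (x 0 * x 1) := by
  rw [coboundary_apply, Fin.sum_univ_two]
  simp [toCochain, Fin.contractNth]
  ring

theorem IsQuasimorphism.coboundary_mem {φ : G → ℝ} (hφ : IsQuasimorphism φ) :
    coboundary 1 (toCochain φ) ∈ cocycles G 2 := by
  refine ⟨?_, coboundary_coboundary 1 _⟩
  obtain ⟨D, hD⟩ := hφ
  exact ⟨D, fun x => by rw [coboundary_toCochain]; exact hD _ _⟩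

/-- The class `[δ¹φ] ∈ H_b^2(G, ℝ)` of a quasimorphism `φ`. -/
def IsQuasimorphism.class {φ : G → ℝ} (hφ : IsQuasimorphism φ) : Hb G 2 :=
  Hb.mk ⟨coboundary 1 (toCochain φ), hφ.coboundary_mem⟩

end Cochains

/-! ### Brooks and Rolli quasimorphisms -/

section Free

variable {ι F : Type*} [Group F]

/-- The reduced word of `g` in the free generating set `b`; a letter `(i, true)` is the `i`-th
generator and `(i, false)` is its inverse. -/
def word [DecidableEq ι] (b : FreeGroupBasis ι F) (g : F) : List (ι × Bool) :=
  (b.repr g).toWord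

/-- The number of occurrences, overlapping ones included, of the list `w` as a block of
consecutive entries of the list `l`: the number of positions at which such a block starts. -/
def occurrences {α : Type*} [DecidableEq α] (w l : List α) : ℕ :=
  ((Finset.range (l.length + 1)).filter fun i => w <+: l.drop i).card

/-- The (big) Brooks quasimorphism on the word `w`, with respect to the free generating set `b`:
the number of subwords `w` in the reduced word of `g` minus the number of subwords `w⁻¹`. -/
def brooks [DecidableEq ι] (b : FreeGroupBasis ι F) (w g : F) : ℝ :=
  (occurrences (word b w) (word b g) : ℝ) - (occurrences (word b w⁻¹) (word b g) : ℝ)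

/-- `[(j₁, m₁), …, (j_k, m_k)]` is a list of syllables in normal form: all `m_i` are non-zero and
no consecutive `j_i` are the same. -/
def IsNormalForm (l : List (ι × ℤ)) : Prop :=
  (∀ p ∈ l, p.2 ≠ 0) ∧ l.IsChain (fun p q => p.1 ≠ q.1)

/-- `φ` is a Rolli quasimorphism with respect to the free generating set `b = (x_i)`: there are
alternating functions `lam i : ℤ → ℝ`, bounded (uniformly in `i`, which is no extra condition if
the generating set is finite), such that `φ(g) = lam_{j₁}(m₁) + ⋯ + lam_{j_k}(m_k)` whenever
`g = x_{j₁}^{m₁} ⋯ x_{j_k}^{m_k}` is the normal form of `g`. -/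
def IsRolli (b : FreeGroupBasis ι F) (φ : F → ℝ) : Prop :=
  ∃ lam : ι → ℤ → ℝ,
    (∀ i m, lam i (-m) = -lam i m) ∧
    (∃ C : ℝ, ∀ i m, |lam i m| ≤ C) ∧
    ∀ l : List (ι × ℤ), IsNormalForm l →
      φ ((l.map fun p => b p.1 ^ p.2).prod) = (l.map fun p => lam p.1 p.2).sum

end Free

end BddCoh

namespace BddCoh

/-! ### Quasicocycles with values in functionals -/

section Quasicocycle

variable {G : Type*} [Group G]

/-! The quasimorphism `φ` is lifted to a family `S g` of finitely supported signed measures on `F`,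
of total mass `φ g`, satisfying a cocycle identity up to an error of uniformly bounded total
variation. Given a bounded cocycle `f` of positive degree, integrate its first argument against `S`.
By the cocycle relation for `f`, the coboundary of this slant is `-(φ ∪ f)` plus the defect of `S`
paired with `f` (`coboundary_slant`). Hence `φ ∪ f + δ(slant S f)` is bounded, and its coboundary is
`δφ ∪ f` because `δf = 0` and `δδ = 0` (`IsQuasicocycle.cup_eq_zero`).

The lift lives on suffixes of the reduced word of `g`: each occurrence of `w` or `w⁻¹` (Brooks), or
each syllable (Rolli), splits its weight evenly between the suffix that begins with it and the
suffix that follows it. Working with suffixes turns appending a word into right translation, up to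
boundedly many terms at the junction. The even split makes inversion an exact sign change combined
with a translation, since the two endpoints are swapped. These two properties suffice
(`isQuasicocycle_of_word`): if `g = p c` and `h = c⁻¹ q` with `p q` reduced, the contributions of
`c` cancel. -/

/-- A family of functionals on `G → ℝ` indexed by `G` (think of finitely supported signed measures
on `G`) that is a cocycle up to an error that is bounded in total variation. -/
def IsQuasicocycle (S : G → (G → ℝ) →ₗ[ℝ] ℝ) : Prop :=
  ∃ D : ℝ, ∀ (g h : G) (f : G → ℝ) (C : ℝ), (∀ x, |f x| ≤ C) →
    |S h f - S (g * h) f + S g (fun x => f (x * h))| ≤ D * C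

theorem IsQuasicocycle.isQuasimorphism {S : G → (G → ℝ) →ₗ[ℝ] ℝ} (hS : IsQuasicocycle S) :
    IsQuasimorphism fun g => S g fun _ => 1 := by
  obtain ⟨D, hD⟩ := hS
  refine ⟨D, fun g h => ?_⟩
  have := hD g h (fun _ => 1) 1 (fun _ => by simp)
  rw [mul_one] at this
  convert this using 2
  ring

theorem contractNth_zero {n : ℕ} (x : Fin (n + 2) → G) :
    Fin.contractNth 0 (· * ·) x =
      Fin.cons (x 0 * x 1) (fun i : Fin n => x i.succ.succ) := by
  funext i
  refine Fin.cases ?_ (fun i => ?_) i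
  · rw [Fin.contractNth_apply_of_eq _ _ _ _ (by simp)]
    rfl
  · rw [Fin.contractNth_apply_of_gt _ _ _ _ (by simp)]
    rfl

theorem contractNth_succ_cons {n : ℕ} (j : Fin (n + 1)) (s : G) (x : Fin (n + 1) → G) :
    Fin.contractNth j.succ (· * ·) (Fin.cons s x : Fin (n + 2) → G) =
      Fin.cons s (Fin.contractNth j (· * ·) x) := by
  funext i
  refine Fin.cases ?_ (fun i => ?_) i
  · rw [Fin.contractNth_apply_of_lt _ _ _ _ (by simp)]
    rfl
  · rw [Fin.cons_succ]
    rcases lt_trichotomy (i : ℕ) j with h | h | h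
    · rw [Fin.contractNth_apply_of_lt _ _ _ _ h, Fin.contractNth_apply_of_lt _ _ _ _ (by simpa)]
      rfl
    · rw [Fin.contractNth_apply_of_eq _ _ _ _ h, Fin.contractNth_apply_of_eq _ _ _ _ (by simpa)]
      rfl
    · rw [Fin.contractNth_apply_of_gt _ _ _ _ h, Fin.contractNth_apply_of_gt _ _ _ _ (by simpa)]
      rfl

/-- The coboundary, with the term that multiplies the first two entries split off. -/
theorem coboundary_cons (n : ℕ) (f : Cochain G (n + 1)) (s : G) (x : Fin (n + 1) → G) :
    coboundary (n + 1) f (Fin.cons s x) =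
      f x - f (Fin.cons (s * x 0) fun i => x i.succ) -
        ∑ j : Fin (n + 1), (-1 : ℝ) ^ ((j : ℕ) + 1) *
          f (Fin.cons s (Fin.contractNth j (· * ·) x)) := by
  rw [coboundary_apply, Fin.sum_univ_succ, contractNth_zero]
  simp only [contractNth_succ_cons, Fin.val_succ, pow_succ _ (_ + 1), Fin.val_zero, Fin.cons_succ]
  simp only [mul_neg, mul_one, neg_mul, Finset.sum_neg_distrib, zero_add, pow_one, one_mul]
  rw [sub_eq_add_neg, sub_eq_add_neg]
  exact (add_assoc _ _ _).symm

/-- The slant of a cochain with a family of functionals in its first argument. -/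
def slant (S : G → (G → ℝ) →ₗ[ℝ] ℝ) {n : ℕ} (f : Cochain G (n + 1)) : Cochain G (n + 1) :=
  fun x => S (x 0) fun s => f (Fin.cons s fun i => x i.succ)

/-- The cocycle relation for `f` at `(s, x)` rewrites the sum over the faces that keep `s` as `f x`
minus the face multiplying `s` by `x 0`. Applying `S g` in the variable `s` turns the constant `f x`
into total mass times `f x`; the remaining terms are the defect of `S`. -/
theorem coboundary_slant (S : G → (G → ℝ) →ₗ[ℝ] ℝ) {n : ℕ} {f : Cochain G (n + 1)}
    (hf : coboundary (n + 1) f = 0) (g : G) (x : Fin (n + 1) → G) :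
    coboundary (n + 1) (slant S f) (Fin.cons g x) =
      S (x 0) (fun s => f (Fin.cons s fun i => x i.succ)) -
        S (g * x 0) (fun s => f (Fin.cons s fun i => x i.succ)) +
        S g (fun s => f (Fin.cons (s * x 0) fun i => x i.succ)) -
        S g (fun _ => 1) * f x := by
  have h : (fun s => ∑ j : Fin (n + 1), (-1 : ℝ) ^ ((j : ℕ) + 1) *
      f (Fin.cons s (Fin.contractNth j (· * ·) x))) =
      f x • (fun _ => 1) - fun s => f (Fin.cons (s * x 0) fun i => x i.succ) := by
    funext s
    have := congrFun hf (Fin.cons s x)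
    rw [coboundary_cons, Pi.zero_apply] at this
    simp only [Pi.sub_apply, Pi.smul_apply, smul_eq_mul, mul_one]
    linarith
  have h' := congrArg (S g) h
  rw [map_sub, map_smul, smul_eq_mul] at h'
  have h2 : (fun s => ∑ j : Fin (n + 1), (-1 : ℝ) ^ ((j : ℕ) + 1) *
      f (Fin.cons s (Fin.contractNth j (· * ·) x))) = ∑ j : Fin (n + 1), (-1 : ℝ) ^ ((j : ℕ) + 1) •
        fun s => f (Fin.cons s (Fin.contractNth j (· * ·) x)) := by
    funext s
    simp
  rw [h2, map_sum] at h'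
  simp only [map_smul, smul_eq_mul] at h'
  rw [coboundary_cons]
  simp only [slant, Fin.cons_zero, Fin.cons_succ]
  rw [h']
  ring

theorem coboundary_comp_cast {p q : ℕ} (h : p = q) (u : Cochain G q) (y : Fin (p + 1) → G) :
    coboundary p (fun x => u fun i => x (Fin.cast h.symm i)) y =
      coboundary q u (fun i => y (Fin.cast (by omega) i)) := by
  subst h
  rfl

/-- The class of a quasimorphism that lifts to a quasicocycle has trivial cup products with all
classes of positive degree. -/
theorem IsQuasicocycle.cup_eq_zero {S : G → (G → ℝ) →ₗ[ℝ] ℝ} (hS : IsQuasicocycle S) {φ : G → ℝ}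
    (hφ : IsQuasimorphism φ) (hSφ : ∀ g, S g (fun _ => 1) = φ g) {k : ℕ} (hk : 0 < k)
    (α : Hb G k) : cup hφ.class α = 0 := by
  obtain ⟨n, rfl⟩ := Nat.exists_eq_succ_of_ne_zero hk.ne'
  obtain ⟨f, rfl⟩ := Submodule.Quotient.mk_surjective _ α
  refine (Submodule.Quotient.mk_eq_zero _).2 ?_
  change cupCochain (coboundary 1 (toCochain φ)) f.1 ∈ coboundaries G (2 + (n + 1))
  have hf : coboundary (n + 1) f.1 = 0 := f.2.2
  obtain ⟨C, hC⟩ := f.2.1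
  obtain ⟨D, hD⟩ := hS
  -- Neither summand of this primitive need be bounded. The second is a coboundary, so it makes the
  -- sum bounded without changing its coboundary.
  refine mem_coboundaries_of_eq (q := 1 + (n + 1)) (by omega)
    (u := cupCochain (toCochain φ) f.1 + fun x : Fin (1 + (n + 1)) → G =>
      coboundary (n + 1) (slant S f.1) fun i => x (Fin.cast (by omega) i)) ⟨D * C, fun x => ?_⟩
    fun x => ?_
  · have hx : (fun i => x (Fin.cast (by omega) i) : Fin (n + 2) → G) =
        Fin.cons (x 0) fun i : Fin (n + 1) => x (Fin.natAdd 1 i) := by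
      funext i
      refine Fin.cases rfl (fun i => ?_) i
      rw [Fin.cons_succ]
      refine congrArg x (Fin.ext ?_)
      simp [add_comm]
    simp only [Pi.add_apply]
    rw [hx, coboundary_slant S hf, hSφ]
    refine le_trans (le_of_eq (congrArg _ ?_)) (hD (x 0) (x (Fin.natAdd 1 0))
      (fun s => f.1 (Fin.cons s fun i => x (Fin.natAdd 1 i.succ))) C fun s => hC _)
    have : cupCochain (toCochain φ) f.1 x =
      φ (x 0) * f.1 (fun i : Fin (n + 1) => x (Fin.natAdd 1 i)) := rfl
    rw [this]
    ring
  · rw [map_add, Pi.add_apply, coboundary_comp_cast (by omega : 1 + (n + 1) = n + 1 + 1),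
      coboundary_coboundary, Pi.zero_apply, add_zero, coboundary_cupCochain, hf, Pi.zero_apply,
      mul_zero, mul_zero, add_zero]
    rfl

end Quasicocycle
-- Reduced words, cancellation, and a criterion for quasicocycles
section Words

variable {ι F : Type*} [Group F]

/-- Evaluation at a point, as a functional. -/
abbrev evalAt (x : F) : (F → ℝ) →ₗ[ℝ] ℝ := LinearMap.proj x

/-- The value of a word in the generators and their inverses. -/
def ev (b : FreeGroupBasis ι F) (l : List (ι × Bool)) : F := b.repr.symm (FreeGroup.mk l)

@[simp]
theorem ev_nil (b : FreeGroupBasis ι F) : ev b [] = 1 := map_one b.repr.symm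

theorem ev_append (b : FreeGroupBasis ι F) (l m : List (ι × Bool)) :
    ev b (l ++ m) = ev b l * ev b m := by
  rw [ev, ← FreeGroup.mul_mk, map_mul]
  rfl

theorem ev_invRev (b : FreeGroupBasis ι F) (l : List (ι × Bool)) :
    ev b (FreeGroup.invRev l) = (ev b l)⁻¹ := by
  rw [ev, ← FreeGroup.inv_mk, map_inv]
  rfl

variable [DecidableEq ι]

theorem ev_word (b : FreeGroupBasis ι F) (g : F) : ev b (word b g) = g := by
  rw [ev, word, FreeGroup.mk_toWord, MulEquiv.symm_apply_apply]

theorem word_ev (b : FreeGroupBasis ι F) {l : List (ι × Bool)} (hl : FreeGroup.IsReduced l) :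
    word b (ev b l) = l := by
  rw [ev, word, MulEquiv.apply_symm_apply, FreeGroup.toWord_mk, hl.reduce_eq]

/-- The maximal cancellation in a product of two reduced words. -/
theorem exists_cancellation (u v : List (ι × Bool)) (hu : FreeGroup.IsReduced u)
    (hv : FreeGroup.IsReduced v) : ∃ p c q, u = p ++ c ∧ v = FreeGroup.invRev c ++ q ∧
      FreeGroup.IsReduced (p ++ q) := by
  induction u using List.reverseRecOn generalizing v with
  | nil => exact ⟨[], [], v, rfl, rfl, hv⟩
  | append_singleton u x ih =>
    rcases v with _ | ⟨y, v⟩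
    · exact ⟨u ++ [x], [], [], by simp, rfl, by simpa using hu⟩
    · by_cases h : x.1 = y.1 ∧ x.2 ≠ y.2
      · obtain ⟨p, c, q, rfl, rfl, h3⟩ := ih v (hu.infix (List.prefix_append _ _).isInfix)
          (hv.infix (List.suffix_cons _ _).isInfix)
        refine ⟨p, c ++ [x], q, by simp, ?_, h3⟩
        have : y = (x.1, !x.2) := Prod.ext h.1.symm (by
          have := h.2
          revert this
          cases x.2 <;> cases y.2 <;> simp)
        simp [FreeGroup.invRev, this]
      · refine ⟨u ++ [x], [], y :: v, by simp, rfl, ?_⟩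
        rw [FreeGroup.IsReduced, List.isChain_append]
        refine ⟨hu, hv, fun a ha c hc => ?_⟩
        simp at ha hc
        subst ha hc
        intro h1
        by_contra h2
        exact h ⟨h1, h2⟩

/-- A family of functionals on reduced words that is additive up to bounded error under
concatenation and antisymmetric under inversion is a quasicocycle. -/
theorem isQuasicocycle_of_word (b : FreeGroupBasis ι F)
    (T : List (ι × Bool) → (F → ℝ) →ₗ[ℝ] ℝ) (D : ℝ)
    (hadd : ∀ (p q : List (ι × Bool)) (f : F → ℝ) (C : ℝ), (∀ x, |f x| ≤ C) →
      |T (p ++ q) f - T p (fun x => f (x * ev b q)) - T q f| ≤ D * C)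
    (hinv : ∀ (c : List (ι × Bool)) (f : F → ℝ),
      T (FreeGroup.invRev c) f = -T c fun x => f (x * (ev b c)⁻¹)) :
    IsQuasicocycle fun g => T (word b g) := by
  -- One `D` for each of the decompositions `p q`, `p c` and `c⁻¹ q`.
  refine ⟨3 * D, fun g h f C hf => ?_⟩
  obtain ⟨p, c, q, hu, hv, hr⟩ := exists_cancellation (word b g) (word b h)
    FreeGroup.isReduced_toWord FreeGroup.isReduced_toWord
  have hh : h = (ev b c)⁻¹ * ev b q := by
    rw [← ev_word b h, hv, ev_append, ev_invRev]
  have hgh : word b (g * h) = p ++ q := by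
    rw [← word_ev b hr, hh, ← ev_word b g, hu, ev_append, ev_append]
    simp [mul_assoc]
  have h1 := hadd p q f C hf
  have h2 := hadd p c (fun x => f (x * h)) C fun x => hf _
  have h3 := hadd (FreeGroup.invRev c) q f C hf
  -- Since `h = c⁻¹ q`, the contribution of `c⁻¹` to `h` is minus that of `c` to `g`, translated by
  -- `h`.
  have e : T (FreeGroup.invRev c) (fun x => f (x * ev b q)) = -T c fun x => f (x * h) := by
    rw [hinv]
    simp only [hh, mul_assoc]
  have e2 : (fun x => f (x * ev b c * h)) = fun x => f (x * ev b q) := by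
    simp [hh, mul_assoc]
  rw [e] at h3
  rw [e2] at h2
  simp only [hgh, hu, hv]
  rw [abs_le] at *
  constructor <;> linarith [h1.1, h1.2, h2.1, h2.2, h3.1, h3.2]

end Words
-- The quasicocycle of a Brooks quasimorphism
section Brooks

variable {ι F : Type*} [Group F] [DecidableEq ι]

/-- The contribution of the start of the word `t` to the Brooks quasicocycle on the word `w`. -/
noncomputable def brooksTerm (b : FreeGroupBasis ι F) (w t : List (ι × Bool)) : (F → ℝ) →ₗ[ℝ] ℝ :=
  (((if w <+: t then 1 else 0) - (if FreeGroup.invRev w <+: t then 1 else 0)) / 2 : ℝ) •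
    (evalAt (ev b t) + evalAt (ev b (t.drop w.length)))

/-- The Brooks quasicocycle on the word `w`, as a function of reduced words. -/
noncomputable def brooksFunctional (b : FreeGroupBasis ι F) (w l : List (ι × Bool)) : (F → ℝ) →ₗ[ℝ] ℝ :=
  ∑ i ∈ Finset.range (l.length + 1), brooksTerm b w (l.drop i)

theorem brooksTerm_apply (b : FreeGroupBasis ι F) (w t : List (ι × Bool)) (f : F → ℝ) :
    brooksTerm b w t f =
      (((if w <+: t then 1 else 0) - (if FreeGroup.invRev w <+: t then 1 else 0)) / 2 : ℝ) *
        (f (ev b t) + f (ev b (t.drop w.length))) := rfl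

theorem abs_brooksTerm_le (b : FreeGroupBasis ι F) (w t : List (ι × Bool)) {f : F → ℝ} {C : ℝ}
    (hf : ∀ x, |f x| ≤ C) : |brooksTerm b w t f| ≤ C := by
  rw [brooksTerm_apply, abs_mul]
  have h1 : |(((if w <+: t then 1 else 0) -
      (if FreeGroup.invRev w <+: t then 1 else 0)) / 2 : ℝ)| ≤ 1 / 2 := by
    split_ifs <;> norm_num
  have h2 : |f (ev b t) + f (ev b (t.drop w.length))| ≤ C + C :=
    (abs_add_le _ _).trans (add_le_add (hf _) (hf _))
  calc _ ≤ 1 / 2 * (C + C) := mul_le_mul h1 h2 (abs_nonneg _) (by norm_num)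
    _ = C := by ring

theorem brooksTerm_append (b : FreeGroupBasis ι F) {w t : List (ι × Bool)}
    (h : w.length ≤ t.length) (q : List (ι × Bool)) (f : F → ℝ) :
    brooksTerm b w (t ++ q) f = brooksTerm b w t fun x => f (x * ev b q) := by
  have key : ∀ v : List (ι × Bool), v.length ≤ t.length → (v <+: t ++ q ↔ v <+: t) :=
    fun v hv => ⟨fun h' => List.prefix_of_prefix_length_le h' (List.prefix_append _ _) hv,
      fun h' => h'.trans (List.prefix_append _ _)⟩
  simp only [brooksTerm_apply]
  rw [List.drop_append_of_le_length h, ev_append, ev_append]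
  simp only [key w h, key (FreeGroup.invRev w) (by simpa using h)]

theorem brooksTerm_eq_zero (b : FreeGroupBasis ι F) {w t : List (ι × Bool)}
    (h : t.length < w.length) : brooksTerm b w t = 0 := by
  have h1 : ¬ w <+: t := fun h' => absurd h'.length_le (by omega)
  have h2 : ¬ FreeGroup.invRev w <+: t := fun h' => absurd h'.length_le (by simpa using h)
  rw [brooksTerm, if_neg h1, if_neg h2]
  simp

theorem brooksFunctional_cons (b : FreeGroupBasis ι F) (w : List (ι × Bool)) (x : ι × Bool)
    (l : List (ι × Bool)) :
    brooksFunctional b w (x :: l) = brooksFunctional b w l + brooksTerm b w (x :: l) := by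
  rw [brooksFunctional, List.length_cons, Finset.sum_range_succ']
  rfl

/-- Only suffixes of `p` shorter than `w` can see the junction, which bounds the error independently
of `p` and `q`. -/
theorem brooksFunctional_append (b : FreeGroupBasis ι F) (w p q : List (ι × Bool)) {f : F → ℝ}
    {C : ℝ} (hf : ∀ x, |f x| ≤ C) :
    |brooksFunctional b w (p ++ q) f - brooksFunctional b w p (fun x => f (x * ev b q)) -
      brooksFunctional b w q f| ≤ (2 * min (p.length : ℝ) w.length + 1) * C := by
  have hC : 0 ≤ C := (abs_nonneg _).trans (hf 1)
  induction p with
  | nil =>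
    -- The empty suffix of `p` has its own term, whence the `+ 1`.
    have : brooksFunctional b w [] = brooksTerm b w [] := by simp [brooksFunctional]
    rw [this, List.nil_append, sub_sub_cancel_left, abs_neg]
    refine (abs_brooksTerm_le b w [] fun x => hf _).trans (le_of_eq ?_)
    simp
  | cons x p ih =>
    rw [List.cons_append, brooksFunctional_cons, brooksFunctional_cons, LinearMap.add_apply,
      LinearMap.add_apply]
    by_cases h : w.length ≤ (x :: p).length
    · have e := brooksTerm_append b h q f
      rw [List.cons_append] at e
      rw [e]
      refine le_trans (le_of_eq (congrArg _ (by ring))) (ih.trans ?_)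
      gcongr
      simp
    -- A short suffix may gain or lose an occurrence across the junction: two terms of size at most
    -- `C`.
    · have h' : ((x :: p).length : ℝ) ≤ w.length := by exact_mod_cast (not_le.1 h).le
      rw [min_eq_left h']
      rw [List.length_cons, Nat.cast_succ] at h' ⊢
      rw [min_eq_left (by linarith)] at ih
      have h1 := abs_brooksTerm_le b w (x :: (p ++ q)) hf
      have h2 := abs_brooksTerm_le b w (x :: p) (f := fun x => f (x * ev b q)) fun x => hf _
      rw [abs_le] at *
      constructor <;> linarith [ih.1, ih.2, h1.1, h1.2, h2.1, h2.2]

/-- Keeping only the starting positions that leave room for `w` makes the index set symmetric, so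
that inversion acts on it by reflection. -/
theorem brooksFunctional_eq_sum (b : FreeGroupBasis ι F) (w l : List (ι × Bool)) :
    brooksFunctional b w l =
      ∑ i ∈ Finset.range (l.length + 1 - w.length), brooksTerm b w (l.drop i) := by
  refine (Finset.sum_subset (Finset.range_subset_range.2 (Nat.sub_le _ _)) fun i _ hi => ?_).symm
  rw [Finset.mem_range] at hi
  rcases Nat.eq_zero_or_pos w.length with h | h
  · rw [Finset.mem_range] at *
    omega
  · refine brooksTerm_eq_zero b ?_
    rw [List.length_drop]
    omega

/-- Inverting `u` exchanges matches with `w` and `w⁻¹`, which flips the sign. Right translation by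
`(p u s)⁻¹` sends the evaluation points `u s` and `s` to `p⁻¹` and `u⁻¹ p⁻¹`, the same two points as
on the left, swapped. -/
theorem brooksTerm_invRev (b : FreeGroupBasis ι F) {w u : List (ι × Bool)}
    (h : u.length = w.length) (p s : List (ι × Bool)) (f : F → ℝ) :
    brooksTerm b w (FreeGroup.invRev u ++ FreeGroup.invRev p) f =
      -brooksTerm b w (u ++ s) fun x => f (x * (ev b (p ++ (u ++ s)))⁻¹) := by
  have key : ∀ v u s : List (ι × Bool), u.length = v.length → (v <+: u ++ s ↔ v = u) := by
    refine fun v u s hv => ⟨fun h' => ?_, fun h' => h' ▸ List.prefix_append _ _⟩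
    exact (List.prefix_of_prefix_length_le h' (List.prefix_append _ _) hv.ge).eq_of_length hv.symm
  have hd : ∀ u s : List (ι × Bool), u.length = w.length → (u ++ s).drop w.length = s :=
    fun u s hu => by rw [← hu, List.drop_left]
  have e1 : w = FreeGroup.invRev u ↔ FreeGroup.invRev w = u := by
    constructor
    · rintro rfl
      exact FreeGroup.invRev_invRev
    · rintro rfl
      exact FreeGroup.invRev_invRev.symm
  have e2 : FreeGroup.invRev w = FreeGroup.invRev u ↔ w = u := FreeGroup.invRev_injective.eq_iff
  simp only [brooksTerm_apply]
  rw [hd _ _ h, hd _ _ (by simpa using h)]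
  simp only [key w u s h, key (FreeGroup.invRev w) u s (by simpa using h),
    key w (FreeGroup.invRev u) (FreeGroup.invRev p) (by simpa using h),
    key (FreeGroup.invRev w) (FreeGroup.invRev u) (FreeGroup.invRev p) (by simpa using h), e1, e2]
  simp only [ev_append, ev_invRev, mul_inv_rev, mul_assoc, mul_inv_cancel_left]
  ring

theorem brooksFunctional_invRev (b : FreeGroupBasis ι F) (w c : List (ι × Bool)) (f : F → ℝ) :
    brooksFunctional b w (FreeGroup.invRev c) f =
      -brooksFunctional b w c fun x => f (x * (ev b c)⁻¹) := by
  rw [brooksFunctional_eq_sum, brooksFunctional_eq_sum, FreeGroup.invRev_length,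
    ← Finset.sum_range_reflect, LinearMap.sum_apply, LinearMap.sum_apply, ← Finset.sum_neg_distrib]
  refine Finset.sum_congr rfl fun i hi => ?_
  rw [Finset.mem_range] at hi
  obtain ⟨p, u, s, rfl, hp, hu⟩ : ∃ p u s, c = p ++ (u ++ s) ∧ p.length = i ∧
      u.length = w.length := by
    refine ⟨c.take i, (c.drop i).take w.length, (c.drop i).drop w.length, by simp, ?_, ?_⟩
    · simp
      omega
    · simp
      omega
  have h1 : (p ++ (u ++ s)).drop i = u ++ s := by rw [← hp, List.drop_left]
  have h2 : (FreeGroup.invRev (p ++ (u ++ s))).drop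
      ((p ++ (u ++ s)).length + 1 - w.length - 1 - i) =
      FreeGroup.invRev u ++ FreeGroup.invRev p := by
    -- The reflected position is where `s⁻¹` ends in `s⁻¹ u⁻¹ p⁻¹`.
    have : (p ++ (u ++ s)).length + 1 - w.length - 1 - i = (FreeGroup.invRev s).length := by
      simp
      omega
    rw [this, FreeGroup.invRev_append, FreeGroup.invRev_append, List.append_assoc, List.drop_left]
  rw [h1, h2, brooksTerm_invRev b hu p s]

theorem isQuasicocycle_brooksFunctional (b : FreeGroupBasis ι F) (w : List (ι × Bool)) :
    IsQuasicocycle fun g => brooksFunctional b w (word b g) := by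
  refine isQuasicocycle_of_word b _ (2 * w.length + 1) (fun p q f C hf => ?_)
    (brooksFunctional_invRev b w)
  have hC : 0 ≤ C := (abs_nonneg _).trans (hf 1)
  refine (brooksFunctional_append b w p q hf).trans ?_
  gcongr
  exact min_le_right _ _

theorem brooksFunctional_one (b : FreeGroupBasis ι F) (w g : F) :
    brooksFunctional b (word b w) (word b g) (fun _ => 1) = brooks b w g := by
  have : word b w⁻¹ = FreeGroup.invRev (word b w) := by
    rw [word, map_inv, FreeGroup.toWord_inv]
    rfl
  rw [brooks, this, occurrences, occurrences, Finset.card_filter, Finset.card_filter,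
    brooksFunctional, LinearMap.sum_apply]
  push_cast
  rw [← Finset.sum_sub_distrib]
  refine Finset.sum_congr rfl fun i _ => ?_
  rw [brooksTerm_apply]
  ring

end Brooks
-- The quasicocycle of a Rolli quasimorphism
section Syllables

variable {ι F : Type*} [Group F]

/-- The value of a list of syllables. -/
def syllEv (b : FreeGroupBasis ι F) (s : List (ι × ℤ)) : F := (s.map fun p => b p.1 ^ p.2).prod

@[simp]
theorem syllEv_nil (b : FreeGroupBasis ι F) : syllEv b [] = 1 := rfl

theorem syllEv_cons (b : FreeGroupBasis ι F) (p : ι × ℤ) (s : List (ι × ℤ)) :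
    syllEv b (p :: s) = b p.1 ^ p.2 * syllEv b s := by
  simp [syllEv]

theorem syllEv_append (b : FreeGroupBasis ι F) (s t : List (ι × ℤ)) :
    syllEv b (s ++ t) = syllEv b s * syllEv b t := by
  simp [syllEv]

/-- The list of syllables of the inverse. -/
def syllInv (s : List (ι × ℤ)) : List (ι × ℤ) := (s.map fun p => (p.1, -p.2)).reverse

@[simp]
theorem syllInv_nil : syllInv ([] : List (ι × ℤ)) = [] := rfl

theorem syllInv_cons (p : ι × ℤ) (s : List (ι × ℤ)) :
    syllInv (p :: s) = syllInv s ++ [(p.1, -p.2)] := by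
  simp [syllInv]

/-- The Rolli quasicocycle, as a function of lists of syllables. -/
noncomputable def rolliFunctional (b : FreeGroupBasis ι F) (lam : ι → ℤ → ℝ) :
    List (ι × ℤ) → (F → ℝ) →ₗ[ℝ] ℝ
  | [] => 0
  | p :: s => (lam p.1 p.2 / 2) • (evalAt (syllEv b (p :: s)) +
      evalAt (syllEv b s)) + rolliFunctional b lam s

theorem rolliFunctional_nil (b : FreeGroupBasis ι F) (lam : ι → ℤ → ℝ) (f : F → ℝ) :
    rolliFunctional b lam [] f = 0 := rfl

theorem rolliFunctional_cons (b : FreeGroupBasis ι F) (lam : ι → ℤ → ℝ) (p : ι × ℤ)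
    (s : List (ι × ℤ)) (f : F → ℝ) :
    rolliFunctional b lam (p :: s) f =
      lam p.1 p.2 / 2 * (f (b p.1 ^ p.2 * syllEv b s) + f (syllEv b s)) +
        rolliFunctional b lam s f := by
  rw [← syllEv_cons]
  rfl

theorem rolliFunctional_append (b : FreeGroupBasis ι F) (lam : ι → ℤ → ℝ)
    (s t : List (ι × ℤ)) (f : F → ℝ) :
    rolliFunctional b lam (s ++ t) f =
      rolliFunctional b lam s (fun x => f (x * syllEv b t)) + rolliFunctional b lam t f := by
  induction s with
  | nil => simp [rolliFunctional_nil]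
  | cons p s ih =>
    rw [List.cons_append, rolliFunctional_cons, rolliFunctional_cons, ih, syllEv_append]
    simp only [mul_assoc]
    ring

/-- The endpoints of each syllable are swapped as in the Brooks case; the sign comes from `lam`
being odd. -/
theorem rolliFunctional_syllInv (b : FreeGroupBasis ι F) {lam : ι → ℤ → ℝ}
    (hlam : ∀ i m, lam i (-m) = -lam i m) (s : List (ι × ℤ)) (f : F → ℝ) :
    rolliFunctional b lam (syllInv s) f =
      -rolliFunctional b lam s fun x => f (x * (syllEv b s)⁻¹) := by
  induction s generalizing f with
  | nil => simp [rolliFunctional_nil]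
  | cons p s ih =>
    rw [syllInv_cons, rolliFunctional_append, ih, rolliFunctional_cons, rolliFunctional_cons,
      rolliFunctional_nil, syllEv_cons, syllEv_cons]
    simp only [hlam, syllEv_nil, mul_inv_rev, mul_one, zpow_neg, mul_assoc, mul_inv_cancel_left,
      mul_inv_cancel]
    ring

theorem rolliFunctional_one (b : FreeGroupBasis ι F) (lam : ι → ℤ → ℝ) (s : List (ι × ℤ)) :
    rolliFunctional b lam s (fun _ => 1) = (s.map fun p => lam p.1 p.2).sum := by
  induction s with
  | nil => rfl
  | cons p s ih =>
    rw [rolliFunctional_cons, ih, List.map_cons, List.sum_cons]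
    ring

/-- The contributions of `s` and `t` cancel exactly; what remains are the terms of the syllables
with exponents `m + n`, `m` and `n`. -/
theorem abs_rolliFunctional_merge_le (b : FreeGroupBasis ι F) {lam : ι → ℤ → ℝ} {K : ℝ}
    (hK : ∀ i m, |lam i m| ≤ K) (s t : List (ι × ℤ)) (i : ι) (m n : ℤ) {f : F → ℝ} {C : ℝ}
    (hf : ∀ x, |f x| ≤ C) :
    |rolliFunctional b lam (s ++ (i, m + n) :: t) f -
      rolliFunctional b lam (s ++ [(i, m)]) (fun x => f (x * syllEv b ((i, n) :: t))) -
        rolliFunctional b lam ((i, n) :: t) f| ≤ 3 * K * C := by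
  have key : ∀ (k : ℤ) (x y : F), |lam i k / 2 * (f x + f y)| ≤ K * C := fun k x y => by
    have h1 : |f x + f y| ≤ 2 * C := (abs_add_le _ _).trans (by linarith [hf x, hf y])
    have h2 := mul_le_mul (hK i k) h1 (abs_nonneg _) ((abs_nonneg _).trans (hK i k))
    rw [abs_mul, abs_div, abs_two]
    linarith
  simp only [rolliFunctional_append, rolliFunctional_cons, rolliFunctional_nil, syllEv_cons,
    syllEv_nil, mul_one, one_mul, mul_assoc, zpow_add]
  have h1 := key (m + n) (b i ^ m * (b i ^ n * syllEv b t)) (syllEv b t)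
  have h2 := key m (b i ^ m * (b i ^ n * syllEv b t)) (b i ^ n * syllEv b t)
  have h3 := key n (b i ^ n * syllEv b t) (syllEv b t)
  rw [abs_le] at *
  constructor <;> linarith [h1.1, h1.2, h2.1, h2.2, h3.1, h3.2]

variable [DecidableEq ι]

/-- Put a syllable in front of a list of syllables, merging it with the first one if these are
powers of the same generator. -/
def syllCons (x : ι × ℤ) : List (ι × ℤ) → List (ι × ℤ)
  | [] => [x]
  | y :: s => if x.1 = y.1 then (x.1, x.2 + y.2) :: s else x :: y :: s

/-- The syllable of one letter. -/
def letterSyll (x : ι × Bool) : ι × ℤ := (x.1, if x.2 then 1 else -1)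

/-- The syllables of a word: maximal blocks of powers of the same generator. -/
def syllables : List (ι × Bool) → List (ι × ℤ)
  | [] => []
  | x :: l => syllCons (letterSyll x) (syllables l)

theorem syllEv_syllCons (b : FreeGroupBasis ι F) (x : ι × ℤ) (s : List (ι × ℤ)) :
    syllEv b (syllCons x s) = b x.1 ^ x.2 * syllEv b s := by
  rcases s with _ | ⟨y, s⟩
  · simp [syllCons, syllEv_cons]
  · rw [syllCons]
    split_ifs with h
    · rw [syllEv_cons, syllEv_cons, ← h, zpow_add, mul_assoc]
    · rw [syllEv_cons]

theorem syllEv_syllables (b : FreeGroupBasis ι F) (l : List (ι × Bool)) :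
    syllEv b (syllables l) = ev b l := by
  induction l with
  | nil => simp [syllables]
  | cons x l ih =>
    rw [syllables, syllEv_syllCons, ih, ← List.singleton_append, ev_append]
    congr 1
    obtain ⟨i, e⟩ := x
    have h : ev b [(i, true)] = b i := rfl
    cases e
    · have := ev_invRev b [(i, true)]
      rw [h] at this
      change ev b [(i, false)] = _ at this
      simp [letterSyll, this]
    · simp [letterSyll, h]

/-- At most one merge happens, even for unreduced words, because `syllCons` keeps a syllable whose
exponent has become zero. The inequality in the second alternative carries the induction and rules
out a merge in `syllables_invRev`. -/
theorem syllables_append (p q : List (ι × Bool)) :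
    (∃ s i m n t, syllables p = s ++ [(i, m)] ∧ syllables q = (i, n) :: t ∧
      syllables (p ++ q) = s ++ (i, m + n) :: t) ∨
    (syllables (p ++ q) = syllables p ++ syllables q ∧
      ∀ x ∈ (syllables p).getLast?, ∀ y ∈ (syllables q).head?, x.1 ≠ y.1) := by
  induction p with
  | nil => exact Or.inr ⟨rfl, by simp [syllables]⟩
  | cons x p ih =>
    rw [List.cons_append, syllables, syllables]
    generalize letterSyll x = z
    rcases ih with ⟨s, i, m, n, t, h1, h2, h3⟩ | ⟨h1, h2⟩
    · left
      rw [h1, h2, h3]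
      rcases s with _ | ⟨y, s⟩
      · by_cases h : z.1 = i
        · exact ⟨[], i, z.2 + m, n, t, by simp [syllCons, h], rfl, by simp [syllCons, h, add_assoc]⟩
        · exact ⟨[z], i, m, n, t, by simp [syllCons, h], rfl, by simp [syllCons, h]⟩
      · by_cases h : z.1 = y.1
        · exact ⟨(z.1, z.2 + y.2) :: s, i, m, n, t, by simp [syllCons, h], rfl,
            by simp [syllCons, h]⟩
        · exact ⟨z :: y :: s, i, m, n, t, by simp [syllCons, h], rfl, by simp [syllCons, h]⟩
    · rw [h1]
      rcases hp : syllables p with _ | ⟨y, s⟩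
      · rcases syllables q with _ | ⟨y, t⟩
        · exact Or.inr ⟨by simp, by simp⟩
        · by_cases h : z.1 = y.1
          · exact Or.inl ⟨[], z.1, z.2, y.2, t, by simp [syllCons], by rw [h], by simp [syllCons, h]⟩
          · exact Or.inr ⟨by simp [syllCons, h], by simpa [syllCons] using h⟩
      · right
        rw [hp] at h2
        by_cases h : z.1 = y.1
        · refine ⟨by simp [syllCons, h], ?_⟩
          rw [syllCons, if_pos h]
          rcases s with _ | ⟨y', s⟩
          · simpa [h] using h2
          · simpa only [List.getLast?_cons_cons] using h2
        · refine ⟨by simp [syllCons, h], ?_⟩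
          rw [syllCons, if_neg h]
          simpa only [List.getLast?_cons_cons] using h2

theorem syllables_invRev (l : List (ι × Bool)) :
    syllables (FreeGroup.invRev l) = syllInv (syllables l) := by
  induction l with
  | nil => rfl
  | cons x l ih =>
    rw [FreeGroup.invRev_cons, syllables]
    have hx : syllables (FreeGroup.invRev [x]) = [((letterSyll x).1, -(letterSyll x).2)] := by
      obtain ⟨i, e⟩ := x
      cases e <;> simp [FreeGroup.invRev, syllables, syllCons, letterSyll]
    have := syllables_append (FreeGroup.invRev l) (FreeGroup.invRev [x])
    rw [ih, hx] at this
    clear hx ih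
    generalize letterSyll x = z at *
    generalize syllables l = r at *
    rcases r with _ | ⟨y, s⟩
    · rcases this with ⟨s, i, m, n, t, h1, h2, h3⟩ | ⟨h1, h2⟩
      · simp at h1
      · simpa [syllCons, syllInv] using h1
    · rw [syllInv_cons] at this
      rcases this with ⟨s', i, m, n, t, h1, h2, h3⟩ | ⟨h1, h2⟩
      · obtain ⟨rfl, h4⟩ := List.append_inj' h1 rfl
        simp only [List.cons.injEq, Prod.mk.injEq, and_true] at h4 h2
        obtain ⟨rfl, rfl⟩ := h4
        obtain ⟨⟨hz, rfl⟩, rfl⟩ := h2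
        rw [h3, syllCons, if_pos hz, syllInv_cons, hz]
        simp [add_comm]
      · have hz : z.1 ≠ y.1 := by simpa [eq_comm] using h2
        rw [h1, syllCons, if_neg hz, syllInv_cons, syllInv_cons]

/-- The induction also records that the leading exponent has the sign of the first letter: in a
reduced word, prepending a letter of the same generator then increases the absolute value of the
exponent, so it never vanishes. -/
theorem isNormalForm_syllables {l : List (ι × Bool)} (hl : FreeGroup.IsReduced l) :
    IsNormalForm (syllables l) ∧ ∀ x ∈ l.head?, ∃ m s, syllables l = (x.1, m) :: s ∧
      0 < m * (letterSyll x).2 := by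
  induction l with
  | nil => exact ⟨⟨by simp [syllables], by simp [syllables]⟩, by simp⟩
  | cons x l ih =>
    obtain ⟨⟨h1, h2⟩, h3⟩ := ih (hl.infix (List.suffix_cons _ _).isInfix)
    have hx : 0 < (letterSyll x).2 * (letterSyll x).2 := by
      unfold letterSyll
      split_ifs <;> norm_num
    have hx0 : (letterSyll x).2 ≠ 0 := fun h => by simp [h] at hx
    rcases l with _ | ⟨y, l⟩
    · exact ⟨⟨by simpa [syllables, syllCons] using hx0, by simp [syllables, syllCons]⟩,
        by simpa [syllables, syllCons, letterSyll] using hx⟩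
    · obtain ⟨m, s, h4, h5⟩ := h3 y rfl
      rw [syllables, h4]
      rw [h4] at h1 h2
      have hxy : x.1 = y.1 → x.2 = y.2 := by
        rw [FreeGroup.IsReduced, List.isChain_cons_cons] at hl
        exact hl.1
      rw [syllCons]
      split_ifs with h
      · have e : letterSyll y = letterSyll x := by 
          have h' : x.1 = y.1 := h
          rw [Prod.ext h' (hxy h')]
        rw [e] at h5
        have h6 : 0 < ((letterSyll x).2 + m) * (letterSyll x).2 := by
          rw [add_mul]
          exact add_pos hx h5
        refine ⟨⟨?_, ?_⟩, ?_⟩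
        · intro p hp
          rcases List.mem_cons.1 hp with rfl | hp
          · intro h0
            simp only at h0
            simp [h0] at h6
          · exact h1 p (List.mem_cons_of_mem _ hp)
        · rw [List.isChain_cons] at h2 ⊢
          refine ⟨fun z hz => ?_, h2.2⟩
          have := h2.1 z hz
          change x.1 ≠ z.1
          change x.1 = y.1 at h
          rwa [h]
        · intro z hz
          obtain rfl : x = z := by simpa using hz
          exact ⟨_, _, rfl, h6⟩
      · refine ⟨⟨?_, List.isChain_cons_cons.2 ⟨h, h2⟩⟩, ?_⟩
        · intro p hp
          rcases List.mem_cons.1 hp with rfl | hp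
          · exact hx0
          · exact h1 p hp
        · intro z hz
          obtain rfl : x = z := by simpa using hz
          exact ⟨_, _, rfl, hx⟩

theorem isQuasicocycle_rolliFunctional (b : FreeGroupBasis ι F) {lam : ι → ℤ → ℝ} {K : ℝ}
    (hlam : ∀ i m, lam i (-m) = -lam i m) (hK : ∀ i m, |lam i m| ≤ K) :
    IsQuasicocycle fun g => rolliFunctional b lam (syllables (word b g)) := by
  -- `|K|` instead of `K`: for empty `ι` the bound `K` could be negative.
  refine isQuasicocycle_of_word b (fun l => rolliFunctional b lam (syllables l)) (3 * |K|)
    (fun p q f C hf => ?_) fun c f => ?_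
  · have hK' : ∀ i m, |lam i m| ≤ |K| := fun i m => (hK i m).trans (le_abs_self K)
    have hC : 0 ≤ C := (abs_nonneg _).trans (hf 1)
    rw [← syllEv_syllables b q]
    rcases syllables_append p q with ⟨s, i, m, n, t, h1, h2, h3⟩ | ⟨h1, -⟩
    · rw [h1, h2, h3]
      exact abs_rolliFunctional_merge_le b hK' s t i m n hf
    · rw [h1, rolliFunctional_append, add_sub_cancel_left, sub_self, abs_zero]
      positivity
  · rw [syllables_invRev, rolliFunctional_syllInv b hlam, syllEv_syllables]

theorem rolliFunctional_word_one (b : FreeGroupBasis ι F) {lam : ι → ℤ → ℝ} {φ : F → ℝ}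
    (hφ : ∀ l : List (ι × ℤ), IsNormalForm l →
      φ ((l.map fun p => b p.1 ^ p.2).prod) = (l.map fun p => lam p.1 p.2).sum) (g : F) :
    rolliFunctional b lam (syllables (word b g)) (fun _ => 1) = φ g := by
  have h : FreeGroup.IsReduced (word b g) := FreeGroup.isReduced_toWord
  rw [rolliFunctional_one, ← hφ _ (isNormalForm_syllables h).1]
  refine congrArg φ ?_
  exact (syllEv_syllables b _).trans (ev_word b g)

end Syllables
end BddCoh

theorem corollaryB {ι F : Type*} [DecidableEq ι] [Nontrivial ι] [Group F]
    (b : FreeGroupBasis ι F) (φ : F → ℝ)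
    (hφ : (∃ w : F, φ = BddCoh.brooks b w) ∨ BddCoh.IsRolli b φ) :
    ∃ hq : BddCoh.IsQuasimorphism φ,
      ∀ k : ℕ, 0 < k → ∀ α : BddCoh.Hb F k, BddCoh.cup hq.class α = 0 := by
  obtain ⟨S, hS, hSφ⟩ : ∃ S : F → (F → ℝ) →ₗ[ℝ] ℝ, BddCoh.IsQuasicocycle S ∧
      ∀ g, S g (fun _ => 1) = φ g := by
    rcases hφ with ⟨w, rfl⟩ | ⟨lam, hlam, ⟨K, hK⟩, hφ⟩
    · exact ⟨_, BddCoh.isQuasicocycle_brooksFunctional b _, BddCoh.brooksFunctional_one b w⟩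
    · exact ⟨_, BddCoh.isQuasicocycle_rolliFunctional b hlam hK,
        BddCoh.rolliFunctional_word_one b hφ⟩
  have hq : BddCoh.IsQuasimorphism φ := by
    rw [← funext hSφ]
    exact hS.isQuasimorphism
  exact ⟨hq, fun k hk α => hS.cup_eq_zero hq hSφ hk α⟩
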